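/- Let $n\ge 0$, $J=[n]\sqcup[n]^*$ with the involution $a\mapsto a^*$, and call $A\subseteq J$ admissible if $A\cap A^*=\emptyset$. A loopless matroid $\mathcal M$ on $J$, with rank function $r$, is called admissible if for every $A\subseteq J$, $r(A)$ is the maximum, over the admissible independent sets $I\subseteq A$ of $\mathcal M$, of the number which is $|I|+2$ if there is a pair $\{a,a^*\}\subseteq A$ such that $I\cup\{a\}$ and $I\cup\{a^*\}$ are both independent with admissible closure, and $|I|$ otherwise. A ranked symplectic matroid $\mathcal S$ is the family of admissible bases of an admissible matroid $\mathcal M$, called an enveloping matroid of $\mathcal S$; the lattice of flats $L(\mathcal S)$ (with respect to $\mathcal M$) consists of the admissible flats of $\mathcal M$ together with $J$, ordered by inclusion. Theorem. Let $\mathcal S$ be a ranked symplectic matroid on $J$ and let $\mathcal M$ be any enveloping matroid of $\mathcal S$. Let $\mu$ be the Möbius function of $L(\mathcal S)$ and, for $F\in L(\mathcal S)$, let $\operatorname{rank}(F)$ be its rank in $L(\mathcal S)$, that is, the maximal length of a chain of $L(\mathcal S)$ ending in $F$. Then for all $F_1\le F_2$ in $L(\mathcal S)$ $$(-1)^{\operatorname{rank}(F_1)-\operatorname{rank}(F_2)}\,\mu(F_1,F_2)>0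 .$$ In particular $\mu(F_1,F_2)$ is never zero. Moreover, if $r(J)\le 1$ or $\mathcal M$ has at least one rank-one flat that is admissible, then also $(-1)^{r(F_1)-r(F_2)}\mu(F_1,F_2)>0$ for all $F_1\le F_2$ in $L(\mathcal S)$. -/

import Mathlib

namespace RankedSymplectic

/-- The ground set `J = [n] ⊔ [n]*`: `Sum.inl i` is `i` and `Sum.inr i` is `i*`. -/
abbrev J (n : ℕ) : Type := Fin n ⊕ Fin n

/-- The involution `a ↦ a*` of `J`. -/
def star {n : ℕ} (a : J n) : J n := a.swap

/-- `A ⊆ J` is admissible if `A ∩ A* = ∅`. -/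
def Admissible {n : ℕ} (A : Set (J n)) : Prop := A ∩ star '' A = ∅

/-- The rank `r(A)` of a set in a matroid on `J`; the rank is finite because `J` is. -/
noncomputable def rank {n : ℕ} (M : Matroid (J n)) (A : Set (J n)) : ℕ := (M.eRk A).toNat

/-- The family of independent sets of `M` whose closure is admissible. -/
def IndepAd {n : ℕ} (M : Matroid (J n)) (I : Set (J n)) : Prop :=
  M.Indep I ∧ Admissible (M.closure I)

open Classical in
/-- The value `|I| + 2` or `|I|` which an admissible independent set `I ⊆ A` contributes to the
rank of `A`; it is `|I| + 2` if for some pair `{a, a*} ⊆ A` both `I ∪ {a}` and `I ∪ {a*}` are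
independent with admissible closure. -/
noncomputable def contribution {n : ℕ} (M : Matroid (J n)) (A I : Set (J n)) : ℕ :=
  if ∃ a : J n, a ∈ A ∧ star a ∈ A ∧ IndepAd M (I ∪ {a}) ∧ IndepAd M (I ∪ {star a}) then
    I.ncard + 2
  else
    I.ncard

/-- A matroid on the ground set `J` is admissible if it is loopless and the rank of every set
`A` is the maximum of the contributions of the admissible independent sets `I ⊆ A`. -/
structure IsAdmissibleMatroid {n : ℕ} (M : Matroid (J n)) : Prop where
  ground_eq : M.E = Set.univ
  loopless : M.Loopless
  rank_eq : ∀ A : Set (J n),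
    IsGreatest {k : ℕ | ∃ I : Set (J n), M.Indep I ∧ Admissible I ∧ I ⊆ A ∧
      k = contribution M A I} (rank M A)

/-- The family of admissible bases of a matroid on `J`. -/
def admissibleBases {n : ℕ} (M : Matroid (J n)) : Set (Set (J n)) :=
  {B | M.IsBase B ∧ Admissible B}

/-- `M` is an enveloping admissible matroid of the family `S` of subsets of `J`. -/
def IsEnveloping {n : ℕ} (M : Matroid (J n)) (S : Set (Set (J n))) : Prop :=
  IsAdmissibleMatroid M ∧ admissibleBases M = S

/-- A ranked symplectic matroid: the family of admissible bases of an admissible matroid. -/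
structure RankedSymplecticMatroid (n : ℕ) where
  bases : Set (Set (J n))
  exists_enveloping : ∃ M : Matroid (J n), IsEnveloping M bases

/-- The lattice of flats of the ranked symplectic matroid enveloped by `M`: the admissible flats
of `M` together with `J`, ordered by inclusion. -/
def FlatLattice {n : ℕ} (M : Matroid (J n)) : Type :=
  {F : Set (J n) // (M.IsFlat F ∧ Admissible F) ∨ F = Set.univ}

instance {n : ℕ} (M : Matroid (J n)) : PartialOrder (FlatLattice M) :=
  inferInstanceAs (PartialOrder {F : Set (J n) // (M.IsFlat F ∧ Admissible F) ∨ F = Set.univ})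

instance {n : ℕ} (M : Matroid (J n)) : Finite (FlatLattice M) :=
  inferInstanceAs (Finite {F : Set (J n) // (M.IsFlat F ∧ Admissible F) ∨ F = Set.univ})

noncomputable instance {n : ℕ} (M : Matroid (J n)) : Fintype (FlatLattice M) :=
  Fintype.ofFinite _

noncomputable instance {n : ℕ} (M : Matroid (J n)) : DecidableEq (FlatLattice M) :=
  Classical.decEq _

open Classical in
noncomputable instance {n : ℕ} (M : Matroid (J n)) : LocallyFiniteOrder (FlatLattice M) :=
  Fintype.toLocallyFiniteOrder

/-- The rank of a flat in the lattice of flats: the length of a longest chain below it. -/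
noncomputable def latticeRank {n : ℕ} {M : Matroid (J n)} (F : FlatLattice M) : ℕ :=
  (Order.height F).toNat

/-- The Möbius function of the lattice of flats, with integer values. -/
noncomputable def moebius {n : ℕ} {M : Matroid (J n)} (F₁ F₂ : FlatLattice M) : ℤ :=
  IncidenceAlgebra.mu ℤ F₁ F₂

end RankedSymplectic

/-!
Write `J` for the ground set and `L` for the lattice of flats, and fix `W ∈ L`.

*Where admissible flats come from.* If an independent set `A` contains a pair `t, t*`, the rank
formula for `A` forces `A \ {t}` and `A \ {t*}` to have admissible closure
(`IsAdmissibleMatroid.admissible_closure_diff`). Hence, whenever `t ∉ F` and `t*` is not in the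
closure of `F ∪ {t}`, both `t` and `t*` span admissible flats over `F`; and a nonempty admissible
flat of corank at least two is covered by another admissible flat. So if some rank-one flat is
admissible, all maximal admissible flats have corank one and `L` is graded by the rank of the
matroid (`IsAdmissibleMatroid.latticeRank_eq`). If none is, `L` has at most the elements `∅` and
`J`, and everything can be read off.

*Signs.* For a set `T` let `S(F, T)` be the sum of `μ(x, W)` over the `x ∈ [F, W]` that meet `T`
(`moebiusSum`). If `F` and `t` have a join `G < W`, then `S(F, T ∪ {t}) = S(F, T) - S(G, T)`;
if they have none and `T` is nonempty, adding `t` changes nothing. The sum vanishes when `T` lies in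
a flat `H` with `F ≤ H < W`. Starting from a set `B` that spans with `F` a flat of corank one and
adding elements one by one, the recursion gives `S(F, T)` the sign opposite to the one expected of
`μ(F, W)`, or zero, for every `T ⊇ B` (`moebiusSum_sign`). The induction works because a part of
`B` spans a flat of corank one over `G` as well (`ExchangeBelow`). Finally,
`μ(F, W) = -μ(G, W) - S(F, W \ G)` for a flat `G` covering `F`; the second term has the right
sign if some flat `H ≥ F` of corank one avoids an element of `G \ F` (`ExtensionBelow`), and the
first is strictly of that sign by induction (`moebius_sign`).

The exchange and the extension property hold below every admissible flat, where `L` is locally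
a geometric lattice, and also below `J`; in the latter case, the elements `t*` serve to produce
admissible flats that avoid `t`.
-/

namespace RankedSymplectic

variable {n : ℕ} {M : Matroid (J n)}

/-! ### Ranks and closures -/

lemma star_star (a : J n) : star (star a) = a := Sum.swap_swap a

lemma star_ne (a : J n) : star a ≠ a := by
  cases a <;> simp [star]

lemma admissible_iff {A : Set (J n)} : Admissible A ↔ ∀ a ∈ A, star a ∉ A := by
  constructor
  · intro h a ha ha'
    have : a ∈ A ∩ star '' A := ⟨ha, star a, ha', star_star a⟩
    rw [h] at this
    exact this
  · intro h
    ext x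
    simp only [Set.mem_inter_iff, Set.mem_image, Set.mem_empty_iff_false, iff_false, not_and,
      not_exists]
    rintro hx a ha rfl
    exact h a ha hx

lemma Admissible.subset {A B : Set (J n)} (hB : Admissible B) (h : A ⊆ B) : Admissible A :=
  admissible_iff.2 fun a ha ha' => admissible_iff.1 hB a (h ha) (h ha')

lemma coe_rank (M : Matroid (J n)) (A : Set (J n)) : (rank M A : ℕ∞) = M.eRk A :=
  ENat.natCast_toNat (ne_top_of_le_ne_top (Set.toFinite A).encard_lt_top.ne (M.eRk_le_encard A))

lemma rank_mono {A B : Set (J n)} (h : A ⊆ B) : rank M A ≤ rank M B := by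
  have := M.eRk_mono h
  rw [← coe_rank, ← coe_rank] at this
  exact_mod_cast this

lemma rank_closure (A : Set (J n)) : rank M (M.closure A) = rank M A := by
  simp [rank]

lemma rank_insert_le (a : J n) (A : Set (J n)) : rank M (insert a A) ≤ rank M A + 1 := by
  have := M.eRk_insert_le_add_one a A
  rw [← coe_rank, ← coe_rank] at this
  exact_mod_cast this

lemma rank_insert (hE : M.E = Set.univ) {a : J n} {A : Set (J n)} (h : a ∉ M.closure A) :
    rank M (insert a A) = rank M A + 1 := by
  have := M.eRk_insert_eq_add_one (X := A) (e := a) ⟨hE ▸ Set.mem_univ a, h⟩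
  rw [← coe_rank, ← coe_rank] at this
  exact_mod_cast this

lemma rank_of_indep {I : Set (J n)} (h : M.Indep I) : rank M I = I.ncard := by
  rw [rank, h.eRk_eq_encard]; rfl

lemma closure_union_closure (A B : Set (J n)) :
    M.closure (M.closure A ∪ B) = M.closure (A ∪ B) := M.closure_union_closure_left_eq A B

lemma subset_cl (hE : M.E = Set.univ) (A : Set (J n)) : A ⊆ M.closure A :=
  M.subset_closure A (hE ▸ Set.subset_univ A)

/-- Comparable sets of the same rank span the same flat. -/
lemma subset_closure_of_rank_le (hE : M.E = Set.univ) {A B : Set (J n)} (h : A ⊆ B)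
    (hr : rank M B ≤ rank M A) : B ⊆ M.closure A := by
  intro b hb
  by_contra hb'
  have h1 := rank_insert hE hb'
  have h2 : rank M (insert b A) ≤ rank M B := rank_mono (Set.insert_subset hb h)
  omega

lemma rank_lt_of_ssubset (hE : M.E = Set.univ) {F G : Set (J n)} (hF : M.closure F = F)
    (h : F ⊂ G) : rank M F < rank M G := by
  by_contra hr
  exact h.2 ((subset_closure_of_rank_le hE h.1 (by omega)).trans hF.subset)

/-- Exchanging `t` for a part of `B`, so that the rank does not drop and `w` is still avoided:
a maximal part of `B` avoiding `w` works, because then every other element of `B` lies in the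
closure of the part together with `w`. -/
lemma exists_subset_rank_le (hE : M.E = Set.univ) {F B : Set (J n)} {t w : J n}
    (ht : t ∉ M.closure (F ∪ B)) (hw : w ∉ M.closure (insert t F)) :
    ∃ B' ⊆ B, w ∉ M.closure (insert t F ∪ B') ∧
      rank M (F ∪ B) ≤ rank M (insert t F ∪ B') := by
  obtain ⟨B', hB'⟩ := (Set.toFinite {X : Set (J n) | X ⊆ B ∧ w ∉ M.closure (insert t F ∪ X)}
    ).exists_maximal ⟨∅, Set.empty_subset _, by simpa using hw⟩
  refine ⟨B', hB'.prop.1, hB'.prop.2, ?_⟩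
  set K := insert t F ∪ B' with hK
  have hsub : insert t (F ∪ B) ⊆ M.closure (insert w K) := by
    have hKs : K ⊆ M.closure (insert w K) :=
      (Set.subset_insert _ _).trans (subset_cl hE _)
    rintro x (rfl | hx | hx)
    · exact hKs (by simp [hK])
    · exact hKs (by simp [hK, hx])
    · by_cases hxB : x ∈ B'
      · exact hKs (by simp [hK, hxB])
      · have hmem : w ∈ M.closure (insert x K) := by
          by_contra hcon
          refine hxB (hB'.le_of_ge (y := insert x B') ⟨Set.insert_subset hx hB'.prop.1, ?_⟩
            (Set.subset_insert _ _) (Set.mem_insert _ _))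
          rwa [Set.union_insert]
        exact M.mem_closure_insert hB'.prop.2 hmem
  have h1 := rank_mono (M := M) hsub
  rw [rank_closure, rank_insert hE ht] at h1
  have h2 := rank_insert_le (M := M) w K
  omega

/-! ### Admissible matroids -/

/-- The rank formula, applied to an independent set `A` containing `t` and `t*`: a maximizing `I`
cannot be `A` itself, so it misses a pair, and this pair is `{t, t*}` because `I` is admissible. -/
lemma IsAdmissibleMatroid.admissible_closure_diff (hM : IsAdmissibleMatroid M) {A : Set (J n)}
    (hA : M.Indep A) {t : J n} (ht : t ∈ A) (ht' : star t ∈ A) :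
    Admissible (M.closure (A \ {star t})) := by
  obtain ⟨⟨I, -, hIad, hIA, hk⟩, -⟩ := hM.rank_eq A
  rw [rank_of_indep hA, contribution] at hk
  split_ifs at hk with hc
  · obtain ⟨c, hcA, hcA', ⟨-, h1⟩, ⟨-, h2⟩⟩ := hc
    have hcI : c ∉ I := fun h => admissible_iff.1 h2 c
      (subset_cl hM.ground_eq _ (.inl h)) (subset_cl hM.ground_eq _ (.inr rfl))
    have hcI' : star c ∉ I := fun h => admissible_iff.1 h1 c
      (subset_cl hM.ground_eq _ (.inr rfl)) (subset_cl hM.ground_eq _ (.inl h))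
    have hI : I = A \ {c, star c} := by
      refine Set.eq_of_subset_of_ncard_le (fun x hx => ⟨hIA hx, ?_⟩) ?_
      · rintro (rfl | rfl)
        · exact hcI hx
        · exact hcI' hx
      · rw [Set.ncard_sdiff (by rintro x (rfl | rfl) <;> assumption),
          Set.ncard_pair (star_ne c).symm]
        omega
    have htc : t = c ∨ t = star c := by
      by_contra! hcon
      refine admissible_iff.1 hIad t ?_ ?_ <;> rw [hI]
      · exact ⟨ht, by simpa using hcon⟩
      · refine ⟨ht', ?_⟩
        rintro (h | h)
        · exact hcon.2 (by rw [← h, star_star])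
        · exact hcon.1 (by rw [← star_star t, h, star_star])
    rcases htc with rfl | rfl
    · refine h1.subset (M.closure_subset_closure ?_)
      rintro x ⟨hx, hx'⟩
      rw [hI]
      by_cases hxt : x = t
      · exact .inr hxt
      · exact .inl ⟨hx, by simpa using ⟨hxt, hx'⟩⟩
    · refine h2.subset (M.closure_subset_closure ?_)
      rintro x ⟨hx, hx'⟩
      rw [star_star] at hx'
      rw [hI]
      by_cases hxt : x = star c
      · exact .inr hxt
      · exact .inl ⟨hx, by simpa using ⟨hx', hxt⟩⟩
  · have : I = A := Set.eq_of_subset_of_ncard_le hIA hk.le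
    subst this
    exact (admissible_iff.1 hIad t ht ht').elim

/-- A set whose span, extended by `t`, does not contain `t*`, has admissible span when extended
by `t` or by `t*`. -/
lemma IsAdmissibleMatroid.admissible_closure_insert (hM : IsAdmissibleMatroid M) {F : Set (J n)}
    {t : J n} (ht : t ∉ M.closure F) (ht' : star t ∉ M.closure (insert t F)) :
    Admissible (M.closure (insert t F)) ∧ Admissible (M.closure (insert (star t) F)) := by
  have hFE : F ⊆ M.E := hM.ground_eq ▸ Set.subset_univ F
  obtain ⟨I, hI⟩ := M.exists_isBasis F
  have htI : t ∉ I := fun h => ht (subset_cl hM.ground_eq _ (hI.subset h))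
  have htI' : star t ∉ I := fun h => ht' (subset_cl hM.ground_eq _ (.inr (hI.subset h)))
  have e (x : J n) : M.closure (insert x I) = M.closure (insert x F) :=
    M.closure_insert_congr_right hI.closure_eq_closure
  have h1 : M.Indep (insert t I) := by
    rw [hI.indep.insert_indep_iff_of_notMem htI, hI.closure_eq_closure]
    exact ⟨hM.ground_eq ▸ Set.mem_univ t, ht⟩
  have h2 : M.Indep (insert (star t) (insert t I)) := by
    rw [h1.insert_indep_iff_of_notMem (by simp [star_ne, htI']), e]
    exact ⟨hM.ground_eq ▸ Set.mem_univ _, ht'⟩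
  rw [← e, ← e]
  constructor
  · have := hM.admissible_closure_diff h2 (t := t) (by simp) (by simp)
    rwa [Set.insert_sdiff_self_of_notMem (by simp [star_ne, htI'])] at this
  · have := hM.admissible_closure_diff h2 (t := star t) (by simp) (by simp [star_star])
    rwa [star_star, Set.insert_comm, Set.insert_sdiff_self_of_notMem
      (by simp [(star_ne t).symm, htI])] at this

/-- A nonempty admissible flat of corank at least two is covered by an admissible flat. -/
lemma IsAdmissibleMatroid.exists_admissible_closure_insert (hM : IsAdmissibleMatroid M)
    {F : Set (J n)} (hF : M.closure F = F) (hFad : Admissible F) (hne : F.Nonempty)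
    (hr : rank M F + 2 ≤ rank M Set.univ) :
    ∃ b ∉ F, Admissible (M.closure (insert b F)) := by
  have hE := hM.ground_eq
  obtain ⟨a, ha⟩ := hne
  have ha' := admissible_iff.1 hFad a ha
  obtain ⟨b, hb⟩ : ∃ b, b ∉ M.closure (insert (star a) F) := by
    by_contra! hcon
    have h1 : rank M Set.univ ≤ rank M (M.closure (insert (star a) F)) :=
      rank_mono fun x _ => hcon x
    rw [rank_closure] at h1
    have := rank_insert_le (M := M) (star a) F
    omega
  have hlo := hM.loopless
  obtain ⟨I, hI, haI⟩ := (M.indep_singleton.2 (M.isNonloop_of_loopless (e := a)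
    (hE ▸ Set.mem_univ a))).subset_isBasis_of_subset (X := F) (by simpa using ha)
    (hE ▸ Set.subset_univ F)
  rw [Set.singleton_subset_iff] at haI
  have e (x : J n) : M.closure (insert x I) = M.closure (insert x F) :=
    M.closure_insert_congr_right hI.closure_eq_closure
  have haI' : star a ∉ I := fun h => ha' (hI.subset h)
  have hbF : b ∉ F := fun h => hb (subset_cl hE _ (.inr h))
  have hba : b ≠ star a := by
    rintro rfl
    exact hb (subset_cl hE _ (.inl rfl))
  have hbI : b ∉ I := fun h => hbF (hI.subset h)
  have h1 : M.Indep (insert (star a) I) := by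
    rw [hI.indep.insert_indep_iff_of_notMem haI', hI.closure_eq_closure, hF]
    exact ⟨hE ▸ Set.mem_univ _, ha'⟩
  have h2 : M.Indep (insert b (insert (star a) I)) := by
    rw [h1.insert_indep_iff_of_notMem (by simp [hba, hbI]), e]
    exact ⟨hE ▸ Set.mem_univ _, hb⟩
  refine ⟨b, hbF, ?_⟩
  have := hM.admissible_closure_diff h2 (t := a) (by simp [haI]) (by simp)
  rwa [Set.insert_comm, Set.insert_sdiff_self_of_notMem (by simp [hba.symm, haI']), e] at this

/-! ### The lattice of flats -/

namespace FlatLattice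

lemma le_iff {F G : FlatLattice M} : F ≤ G ↔ F.val ⊆ G.val := Iff.rfl

lemma lt_iff {F G : FlatLattice M} : F < G ↔ F.val ⊂ G.val := Iff.rfl

lemma closure_eq (hE : M.E = Set.univ) (F : FlatLattice M) : M.closure F.val = F.val := by
  rcases F.prop with h | h
  · exact h.1.closure
  · rw [h]
    exact Set.eq_univ_of_univ_subset (subset_cl hE _)

lemma closure_subset (hE : M.E = Set.univ) (F : FlatLattice M) {A : Set (J n)} (h : A ⊆ F.val) :
    M.closure A ⊆ F.val :=
  (M.closure_subset_closure h).trans (F.closure_eq hE).subset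

lemma rank_lt (hE : M.E = Set.univ) {F G : FlatLattice M} (h : F < G) :
    rank M F.val < rank M G.val :=
  rank_lt_of_ssubset hE (F.closure_eq hE) (lt_iff.1 h)

lemma admissible_of_lt {F G : FlatLattice M} (h : F < G) : Admissible F.val := by
  rcases F.prop with hF | hF
  · exact hF.2
  · exact absurd (Set.subset_univ _) (hF ▸ (lt_iff.1 h).2)

end FlatLattice

/-- The set `A` spans an element of the lattice of flats strictly below `W`; the join of the
elements of `A` is then computed in the lattice of flats as in the matroid. -/
def SpansBelow (W : FlatLattice M) (A : Set (J n)) : Prop :=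
  Admissible (M.closure A) ∧ M.closure A ⊂ W.val

namespace SpansBelow

/-- The element of the lattice of flats spanned by `A`. -/
def flat {W : FlatLattice M} {A : Set (J n)} (h : SpansBelow W A) : FlatLattice M :=
  ⟨M.closure A, Or.inl ⟨M.isFlat_closure A, h.1⟩⟩

lemma flat_lt {W : FlatLattice M} {A : Set (J n)} (h : SpansBelow W A) : h.flat < W := h.2

lemma val_flat {W : FlatLattice M} {A : Set (J n)} (h : SpansBelow W A) :
    h.flat.val = M.closure A := rfl

lemma of_subset (hE : M.E = Set.univ) {F W : FlatLattice M} (h : F < W) {A : Set (J n)}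
    (hA : A ⊆ F.val) : SpansBelow W A :=
  ⟨(FlatLattice.admissible_of_lt h).subset (F.closure_subset hE hA),
    (F.closure_subset hE hA).trans_ssubset h⟩

lemma flat_le_iff (hE : M.E = Set.univ) {W : FlatLattice M} {A : Set (J n)} (h : SpansBelow W A)
    {x : FlatLattice M} : h.flat ≤ x ↔ A ⊆ x.val :=
  ⟨fun hx => (subset_cl hE A).trans hx, fun hx => x.closure_subset hE hx⟩

end SpansBelow

/-- If `A` spans nothing in the lattice strictly below `W`, then only `W` contains `A`. -/
lemma eq_of_not_spansBelow (hE : M.E = Set.univ) {W x : FlatLattice M} {A : Set (J n)}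
    (h : ¬ SpansBelow W A) (hx : x ≤ W) (hA : A ⊆ x.val) : x = W := by
  by_contra hne
  exact h (SpansBelow.of_subset hE (lt_of_le_of_ne hx hne) hA)

/-- The flats between `F` and the flat that covers it. -/
lemma eq_or_eq_of_le_closure_insert (hE : M.E = Set.univ) {F x : FlatLattice M} {t : J n}
    (h1 : F ≤ x) (h2 : x.val ⊆ M.closure (insert t F.val)) :
    x = F ∨ x.val = M.closure (insert t F.val) := by
  by_cases hx : x.val ⊆ F.val
  · exact .inl (le_antisymm hx h1)
  · obtain ⟨s, hs, hsF⟩ := Set.not_subset.1 hx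
    refine .inr (h2.antisymm (x.closure_subset hE (Set.insert_subset ?_ h1)))
    have := M.mem_closure_insert (by rwa [F.closure_eq hE]) (h2 hs)
    exact x.closure_subset hE (Set.insert_subset hs h1) this

/-! ### Partial sums of the Möbius function -/

open Classical in
/-- The sum of `μ(x, W)` over the elements `x` of the interval `[F, W]` which meet `T`. -/
noncomputable def moebiusSum (W F : FlatLattice M) (T : Set (J n)) : ℤ :=
  ∑ x ∈ Finset.Icc F W with (x.val ∩ T).Nonempty, moebius x W

lemma moebiusSum_empty (W F : FlatLattice M) : moebiusSum W F ∅ = 0 := by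
  simp [moebiusSum]

lemma sum_moebius_of_lt {F W : FlatLattice M} (h : F < W) :
    ∑ x ∈ Finset.Icc F W, moebius x W = 0 :=
  (IncidenceAlgebra.sum_Icc_mu_left F W).trans (if_neg h.ne)

lemma moebiusSum_of_inter_nonempty {F W : FlatLattice M} (h : F < W) {T : Set (J n)}
    (hT : (F.val ∩ T).Nonempty) : moebiusSum W F T = 0 := by
  classical
  rw [moebiusSum, Finset.filter_true_of_mem, sum_moebius_of_lt h]
  intro x hx
  exact hT.mono (Set.inter_subset_inter_left _ (Finset.mem_Icc.1 hx).1)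

open Classical in
lemma moebiusSum_insert_eq_add (W F : FlatLattice M) (t : J n) (T : Set (J n)) :
    moebiusSum W F (insert t T) = moebiusSum W F T +
      ∑ x ∈ Finset.Icc F W with t ∈ x.val ∧ ¬ (x.val ∩ T).Nonempty, moebius x W := by
  rw [moebiusSum, moebiusSum, ← Finset.sum_union]
  · congr 1
    ext x
    have : (x.val ∩ insert t T).Nonempty ↔ t ∈ x.val ∨ (x.val ∩ T).Nonempty := by
      by_cases ht : t ∈ x.val
      · simpa [ht] using ⟨t, ht, by simp⟩
      · rw [Set.inter_insert_of_notMem ht]; simp [ht]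
    simp only [Finset.mem_filter, Finset.mem_union, this]
    tauto
  · rw [Finset.disjoint_filter]
    intro x _ h h'
    exact h'.2 h

/-- The recursion for `moebiusSum`, when `t` and `F` have a join strictly below `W`. -/
lemma moebiusSum_insert (hE : M.E = Set.univ) {W F : FlatLattice M} {t : J n} (T : Set (J n))
    (h : SpansBelow W (insert t F.val)) :
    moebiusSum W F (insert t T) = moebiusSum W F T - moebiusSum W h.flat T := by
  classical
  have h0 := sum_moebius_of_lt h.flat_lt
  rw [← Finset.sum_filter_add_sum_filter_not _ (fun x => (x.val ∩ T).Nonempty)] at h0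
  rw [moebiusSum_insert_eq_add, sub_eq_add_neg]
  congr 1
  rw [eq_neg_iff_add_eq_zero, add_comm, ← h0, moebiusSum]
  congr 2
  ext x
  simp only [Finset.mem_filter, Finset.mem_Icc, h.flat_le_iff hE, Set.insert_subset_iff,
    FlatLattice.le_iff]
  tauto

/-- The recursion for `moebiusSum`, when only `W` lies above `t` and `F`. -/
lemma moebiusSum_insert_of_not (hE : M.E = Set.univ) {W F : FlatLattice M} {t : J n}
    {T : Set (J n)} (hT : T.Nonempty) (hTW : T ⊆ W.val) (h : ¬ SpansBelow W (insert t F.val)) :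
    moebiusSum W F (insert t T) = moebiusSum W F T := by
  classical
  rw [moebiusSum_insert_eq_add, Finset.filter_false_of_mem, Finset.sum_empty, add_zero]
  rintro x hx ⟨htx, hx'⟩
  obtain ⟨hFx, hxW⟩ := Finset.mem_Icc.1 hx
  obtain rfl := eq_of_not_spansBelow hE h hxW (Set.insert_subset htx hFx)
  exact hx' (by rwa [Set.inter_eq_right.2 hTW])

/-- Adding the elements of a flat strictly below `W` one at a time leaves the sum zero: all the
joins involved exist below that flat. -/
lemma moebiusSum_eq_zero (hE : M.E = Set.univ) {W H : FlatLattice M} (hH : H < W)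
    (T : Set (J n)) : T ⊆ H.val → ∀ F ≤ H, moebiusSum W F T = 0 := by
  induction T, Set.toFinite T using Set.Finite.induction_on with
  | empty => exact fun _ F _ => moebiusSum_empty W F
  | @insert t T _ _ ih =>
    intro hT F hF
    have hs : insert t F.val ⊆ H.val := Set.insert_subset (hT (by simp)) hF
    have h : SpansBelow W (insert t F.val) := .of_subset hE hH hs
    have hT' := (Set.subset_insert t T).trans hT
    rw [moebiusSum_insert hE T h, ih hT' F hF, ih hT' h.flat ((h.flat_le_iff hE).2 hs), sub_zero]

/-- When `F` is covered by `W`, only `W` itself can contribute to the sum. -/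
lemma moebiusSum_nonneg_of_covBy {W F : FlatLattice M} (h : F ⋖ W) (T : Set (J n)) :
    0 ≤ moebiusSum W F T := by
  classical
  by_cases hT : (F.val ∩ T).Nonempty
  · exact (moebiusSum_of_inter_nonempty h.lt hT).ge
  · refine Finset.sum_nonneg fun x hx => ?_
    rw [Finset.mem_filter, Finset.mem_Icc] at hx
    rcases h.eq_or_eq hx.1.1 hx.1.2 with rfl | rfl
    · exact absurd hx.2 hT
    · simp [moebius]

/-! ### Signs of the Möbius function -/

/-- The exchange property of the coatoms below `W`: a set `B` which together with `F` spans
a flat of corank one below `W` has a subset doing so together with an atom `t` over `F`. -/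
def ExchangeBelow (W : FlatLattice M) : Prop :=
  ∀ (F : FlatLattice M) (t : J n) (B : Set (J n)),
    SpansBelow W (insert t F.val) → SpansBelow W (F.val ∪ B) →
    rank M (F.val ∪ B) + 1 = rank M W.val →
    ∃ B' ⊆ B, SpansBelow W (insert t F.val ∪ B') ∧
      rank M (insert t F.val ∪ B') + 1 = rank M W.val

/-- Below `W`, every flat of corank at least two has an atom `t` over it and a flat `H` of corank
one above it that avoids `t`. -/
def ExtensionBelow (W : FlatLattice M) : Prop :=
  ∀ F < W, rank M F.val + 2 ≤ rank M W.val →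
    ∃ t ∉ F.val, SpansBelow W (insert t F.val) ∧
      ∃ H : FlatLattice M, F ≤ H ∧ H < W ∧ t ∉ H.val ∧ rank M H.val + 1 = rank M W.val

lemma moebius_of_covBy {F G : FlatLattice M} (h : F ⋖ G) : moebius F G = -1 := by
  have := sum_moebius_of_lt h.lt
  have hIcc : Finset.Icc F G = {F, G} := by
    rw [← Finset.coe_inj, Finset.coe_Icc, h.Icc_eq]
    simp
  have h1 : moebius G G = 1 := by simp [moebius]
  rw [hIcc, Finset.sum_pair h.lt.ne, h1] at this
  linarith

lemma covBy_of_rank (hE : M.E = Set.univ) {F W : FlatLattice M} (h : F < W)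
    (hr : rank M F.val + 1 = rank M W.val) : F ⋖ W := by
  refine ⟨h, fun x h1 h2 => ?_⟩
  have := FlatLattice.rank_lt hE h1
  have := FlatLattice.rank_lt hE h2
  omega

/-- The sign of `moebiusSum` for sets `T` that contain, over `F`, a spanning set of some flat of
corank one. This is the algebraic shadow of a shelling: `T` plays the part of an initial segment
of the atoms over `F`, and the exchange property hands the hypothesis down to the flats over
`F` when the segment grows. -/
lemma moebiusSum_sign (hE : M.E = Set.univ) {W : FlatLattice M} (hW : ExchangeBelow W) (k : ℕ) :
    ∀ (F : FlatLattice M) (B T : Set (J n)), F < W → rank M F.val + k = rank M W.val → B ⊆ T →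
      T ⊆ W.val → SpansBelow W (F.val ∪ B) → rank M (F.val ∪ B) + 1 = rank M W.val →
      0 ≤ (-1 : ℤ) ^ (k + 1) * moebiusSum W F T := by
  induction k with
  | zero =>
    intro F B T hF hk
    exact absurd (FlatLattice.rank_lt hE hF) (by omega)
  | succ k ih =>
    intro F B T hF hk hBT hTW hB hBr
    rcases Nat.eq_zero_or_pos k with rfl | hkpos
    · simpa using moebiusSum_nonneg_of_covBy (covBy_of_rank hE hF hk) T
    have hBne : B.Nonempty := by
      rw [Set.nonempty_iff_ne_empty]
      rintro rfl
      rw [Set.union_empty] at hBr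
      omega
    have key (U : Set (J n)) : B ∪ U ⊆ W.val →
        0 ≤ (-1 : ℤ) ^ (k + 1 + 1) * moebiusSum W F (B ∪ U) := by
      induction U, Set.toFinite U using Set.Finite.induction_on with
      | empty =>
        intro _
        rw [Set.union_empty, moebiusSum_eq_zero hE hB.flat_lt B, mul_zero]
        · exact Set.subset_union_right.trans (subset_cl hE _)
        · exact Set.subset_union_left.trans (subset_cl hE _)
      | @insert t U _ _ ihU =>
        intro hUW
        rw [Set.union_insert] at hUW ⊢
        have hUW' := (Set.subset_insert _ _).trans hUW
        have hpos := ihU hUW'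
        by_cases ht : SpansBelow W (insert t F.val)
        · by_cases htF : t ∈ F.val
          · rw [moebiusSum_of_inter_nonempty hF ⟨t, htF, by simp⟩, mul_zero]
          · obtain ⟨B', hB', hs, hr⟩ := hW F t B ht hB hBr
            have hcl : M.closure (ht.flat.val ∪ B') = M.closure (insert t F.val ∪ B') :=
              closure_union_closure _ _
            have hGr : rank M ht.flat.val = rank M F.val + 1 := by
              rw [ht.val_flat, rank_closure, rank_insert hE (by rwa [F.closure_eq hE])]
            have hG := ih ht.flat B' (B ∪ U) ht.flat_lt (by omega)
              (hB'.trans Set.subset_union_left) hUW' (by rwa [SpansBelow, hcl])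
              (by rw [← rank_closure, hcl, rank_closure]; exact hr)
            rw [moebiusSum_insert hE _ ht, mul_sub]
            rw [pow_succ] at hpos ⊢
            linarith
        · rwa [moebiusSum_insert_of_not hE (hBne.mono Set.subset_union_left) hUW' ht]
    simpa [Set.union_eq_self_of_subset_left hBT] using key T (by
      simpa [Set.union_eq_self_of_subset_left hBT] using hTW)

/-- The Möbius function alternates in sign below `W`. The step compares the interval `[F, W]`
with `[G, W]`, where `G` is spanned by `F` and an atom `t` over `F`: the elements of `[F, W]` are
`F`, `G`, and those that meet the complement of `G`, among which are the elements over `F` of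
a flat `H` of corank one that avoids `t`. -/
lemma moebius_sign (hE : M.E = Set.univ) {W : FlatLattice M} (hW : ExchangeBelow W)
    (hW' : ExtensionBelow W) (k : ℕ) :
    ∀ F ≤ W, rank M F.val + k = rank M W.val → 0 < (-1 : ℤ) ^ k * moebius F W := by
  classical
  induction k with
  | zero =>
    intro F hF hk
    obtain rfl : F = W := by
      by_contra hne
      exact absurd (FlatLattice.rank_lt hE (lt_of_le_of_ne hF hne)) (by omega)
    simp [moebius]
  | succ k ih =>
    intro F hF hk
    have hFW : F < W := lt_of_le_of_ne hF (by rintro rfl; omega)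
    rcases Nat.eq_zero_or_pos k with rfl | hkpos
    · simp [moebius_of_covBy (covBy_of_rank hE hFW hk)]
    obtain ⟨t, htF, ht, H, hFH, hHW, htH, hHr⟩ := hW' F hFW (by omega)
    set G := ht.flat with hG
    have hFG : F ≤ G := (Set.subset_insert _ _).trans (subset_cl hE _)
    have htG : t ∈ G.val := subset_cl hE _ (Set.mem_insert _ _)
    have hGr : rank M G.val = rank M F.val + 1 := by
      rw [ht.val_flat, rank_closure, rank_insert hE (by rwa [F.closure_eq hE])]
    have hne : F ≠ G := by
      intro h
      rw [← h] at htG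
      exact htF htG
    have hGpos := ih G ht.flat_lt.le (by omega)
    -- The closure of `insert s F` is all of `G` for `s ∈ G \ F`, so that `H` meets `G` in `F`.
    have hHG : H.val ∩ G.val ⊆ F.val := by
      rintro s ⟨hsH, hsG⟩
      by_contra hsF
      have := M.mem_closure_insert (X := F.val) (by rwa [F.closure_eq hE]) hsG
      exact htH (H.closure_subset hE (Set.insert_subset hsH hFH) this)
    have hun : F.val ∪ H.val \ G.val = H.val := by
      refine Set.Subset.antisymm (Set.union_subset hFH Set.sdiff_subset) fun x hx => ?_
      by_cases hxG : x ∈ G.val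
      · exact .inl (hHG ⟨hx, hxG⟩)
      · exact .inr ⟨hx, hxG⟩
    have hS := moebiusSum_sign hE hW (k + 1) F (H.val \ G.val) (W.val \ G.val) hFW hk
      (Set.sdiff_subset_sdiff_left hHW.le) Set.sdiff_subset
      (by rw [hun]; exact .of_subset hE hHW subset_rfl) (by rw [hun]; exact hHr)
    have hsum := sum_moebius_of_lt hFW
    rw [← Finset.sum_filter_add_sum_filter_not _
      (fun x => (x.val ∩ (W.val \ G.val)).Nonempty)] at hsum
    have hpair : (Finset.Icc F W).filter (fun x => ¬ (x.val ∩ (W.val \ G.val)).Nonempty) =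
        {F, G} := by
      ext x
      simp only [Finset.mem_filter, Finset.mem_Icc, Finset.mem_insert, Finset.mem_singleton]
      constructor
      · rintro ⟨⟨h1, h2⟩, h3⟩
        refine (eq_or_eq_of_le_closure_insert hE h1 fun s hs => ?_).imp_right Subtype.ext
        by_contra hsG
        exact h3 ⟨s, hs, h2 hs, hsG⟩
      · have hnot (x : FlatLattice M) (hx : x ≤ G) : ¬ (x.val ∩ (W.val \ G.val)).Nonempty := by
          rintro ⟨s, hs, -, hsG⟩
          exact hsG (hx hs)
        rintro (rfl | rfl)
        · exact ⟨⟨le_rfl, hF⟩, hnot _ hFG⟩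
        · exact ⟨⟨hFG, ht.flat_lt.le⟩, hnot _ le_rfl⟩
    rw [hpair, Finset.sum_pair hne] at hsum
    change moebiusSum W F (W.val \ G.val) + _ = 0 at hsum
    have : moebius F W = -moebius G W - moebiusSum W F (W.val \ G.val) := by linarith
    rw [this, mul_sub]
    rw [pow_succ, pow_succ] at hS
    rw [pow_succ]
    linarith

/-! ### Exchange and extension below an admissible flat -/

/-- The exchange property follows if some `w ∈ W` certifies that spans avoiding `w` lie in the
lattice strictly below `W`. -/
lemma exchangeBelow_of_exists (hE : M.E = Set.univ) {W : FlatLattice M}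
    (h : ∀ (F : FlatLattice M) (t : J n) (B : Set (J n)), SpansBelow W (insert t F.val) →
      SpansBelow W (F.val ∪ B) → t ∉ M.closure (F.val ∪ B) →
      ∃ w ∉ M.closure (insert t F.val), ∀ B' ⊆ B, w ∉ M.closure (insert t F.val ∪ B') →
        SpansBelow W (insert t F.val ∪ B')) :
    ExchangeBelow W := by
  intro F t B ht hB hr
  by_cases htB : t ∈ M.closure (F.val ∪ B)
  · have hcl : M.closure (insert t F.val ∪ B) = M.closure (F.val ∪ B) := by
      rw [Set.insert_union, M.closure_insert_eq_of_mem_closure htB]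
    exact ⟨B, subset_rfl, by rwa [SpansBelow, hcl],
      by rw [← rank_closure, hcl, rank_closure]; exact hr⟩
  · obtain ⟨w, hw, hs⟩ := h F t B ht hB htB
    obtain ⟨B', hB', hwB', hle⟩ := exists_subset_rank_le hE htB hw
    have hsp := hs B' hB' hwB'
    have := FlatLattice.rank_lt hE hsp.flat_lt
    rw [hsp.val_flat, rank_closure] at this
    exact ⟨B', hB', hsp, by omega⟩

lemma exchangeBelow_of_admissible (hE : M.E = Set.univ) {W : FlatLattice M}
    (hW : Admissible W.val) : ExchangeBelow W := by
  refine exchangeBelow_of_exists hE fun F t B ht hB _ => ?_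
  obtain ⟨w, hwW, hw⟩ := Set.exists_of_ssubset ht.2
  refine ⟨w, hw, fun B' hB' hwB' => ?_⟩
  have hsub : M.closure (insert t F.val ∪ B') ⊆ W.val := by
    refine W.closure_subset hE (Set.union_subset ((subset_cl hE _).trans ht.2.1) ?_)
    exact hB'.trans (Set.subset_union_right.trans ((subset_cl hE _).trans hB.2.1))
  exact ⟨hW.subset hsub, hsub, fun h => hwB' (h hwW)⟩

lemma extensionBelow_of_admissible (hE : M.E = Set.univ) {W : FlatLattice M}
    (hW : Admissible W.val) : ExtensionBelow W := by
  intro F hF hr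
  obtain ⟨t, htW, htF⟩ := Set.exists_of_ssubset (FlatLattice.lt_iff.1 hF)
  have hsub (A : Set (J n)) (hA : A ⊆ W.val) (hAr : rank M A < rank M W.val) :
      SpansBelow W A := by
    have hA' := W.closure_subset hE hA
    refine ⟨hW.subset hA', hA', fun h => ?_⟩
    have := rank_mono (M := M) h
    rw [rank_closure] at this
    omega
  refine ⟨t, htF, hsub _ (Set.insert_subset htW hF.le) ?_, ?_⟩
  · have := rank_insert_le (M := M) t F.val
    omega
  obtain ⟨I, hI⟩ := M.exists_isBasis F.val (by rw [hE]; exact Set.subset_univ _)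
  have htI : t ∉ I := fun h => htF (hI.subset h)
  have h1 : M.Indep (insert t I) := by
    rw [hI.indep.insert_indep_iff_of_notMem htI, hI.closure_eq_closure, F.closure_eq hE]
    exact ⟨hE ▸ Set.mem_univ t, htF⟩
  obtain ⟨K, hK, hIK⟩ := h1.subset_isBasis_of_subset (X := W.val)
    (Set.insert_subset htW (hI.subset.trans hF.le)) (by rw [hE]; exact Set.subset_univ _)
  have htK : t ∈ K := hIK (Set.mem_insert _ _)
  have htK' : t ∉ M.closure (K \ {t}) := hK.indep.notMem_closure_sdiff_of_mem htK
  have hKr : rank M (K \ {t}) + 1 = rank M W.val := by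
    rw [← rank_insert hE htK', Set.insert_sdiff_self_of_mem htK, ← rank_closure,
      hK.closure_eq_closure, rank_closure]
  have hs := hsub (K \ {t}) (Set.sdiff_subset.trans hK.subset) (by omega)
  refine ⟨hs.flat, ?_, hs.flat_lt, htK', by rwa [hs.val_flat, rank_closure]⟩
  rw [FlatLattice.le_iff, hs.val_flat, ← F.closure_eq hE, ← hI.closure_eq_closure]
  refine M.closure_subset_closure fun x hx => ⟨hIK (.inr hx), ?_⟩
  rintro rfl
  exact htI hx

/-! ### Exchange and extension below the whole ground set -/

/-- Here `w = t*` certifies spans below `J`. -/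
lemma IsAdmissibleMatroid.exchangeBelow (hM : IsAdmissibleMatroid M) {W : FlatLattice M}
    (hW : W.val = Set.univ) : ExchangeBelow W := by
  have hE := hM.ground_eq
  refine exchangeBelow_of_exists hE fun F t B ht _ htB => ?_
  refine ⟨star t, admissible_iff.1 ht.1 t (subset_cl hE _ (.inl rfl)), fun B' hB' hs => ?_⟩
  have h1 : t ∉ M.closure (F.val ∪ B') := fun h =>
    htB (M.closure_subset_closure (Set.union_subset_union_right _ hB') h)
  refine ⟨?_, ?_⟩
  · rw [Set.insert_union] at hs ⊢
    exact (hM.admissible_closure_insert h1 hs).1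
  · rw [hW, Set.ssubset_univ_iff]
    exact fun h => hs (by rw [h]; exact Set.mem_univ _)

/-- Every admissible flat of corank at least two is covered by an admissible flat, as soon as
the empty flat is. -/
lemma IsAdmissibleMatroid.exists_cover (hM : IsAdmissibleMatroid M)
    (ha : ∃ a : J n, Admissible (M.closure {a})) {F : Set (J n)} (hF : M.closure F = F)
    (hFad : Admissible F) (hr : rank M F + 2 ≤ rank M Set.univ) :
    ∃ b ∉ F, Admissible (M.closure (insert b F)) := by
  rcases F.eq_empty_or_nonempty with rfl | hne
  · obtain ⟨a, ha⟩ := ha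
    exact ⟨a, Set.notMem_empty a, by simpa using ha⟩
  · exact hM.exists_admissible_closure_insert hF hFad hne hr

/-- Maximal admissible flats have corank one. -/
lemma IsAdmissibleMatroid.exists_coatom (hM : IsAdmissibleMatroid M)
    (ha : ∃ a : J n, Admissible (M.closure {a})) (k : ℕ) :
    ∀ A : Set (J n), Admissible (M.closure A) → rank M A + 1 + k = rank M Set.univ →
      ∃ H : Set (J n), A ⊆ H ∧ Admissible (M.closure H) ∧ rank M H + 1 = rank M Set.univ := by
  induction k with
  | zero => exact fun A hA hr => ⟨A, subset_rfl, hA, hr⟩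
  | succ k ih =>
    intro A hA hr
    obtain ⟨b, hb, hbad⟩ := hM.exists_cover ha (M.closure_closure A) hA
      (by rw [rank_closure]; omega)
    rw [M.closure_insert_closure_eq_closure_insert] at hbad
    obtain ⟨H, hH, h⟩ := ih (insert b A) hbad (by rw [rank_insert hM.ground_eq hb]; omega)
    exact ⟨H, (Set.subset_insert _ _).trans hH, h⟩

lemma spansBelow_of_rank {W : FlatLattice M} (hW : W.val = Set.univ) {A : Set (J n)}
    (hA : Admissible (M.closure A)) (hr : rank M A < rank M Set.univ) : SpansBelow W A := by
  refine ⟨hA, ?_⟩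
  rw [hW, Set.ssubset_univ_iff]
  intro h
  rw [← rank_closure, h] at hr
  exact hr.false

/-- If `t` spans an admissible flat over `F`, then so does `t*`, and a maximal admissible flat
over the latter avoids `t`. -/
lemma IsAdmissibleMatroid.extensionBelow (hM : IsAdmissibleMatroid M)
    (ha : ∃ a : J n, Admissible (M.closure {a})) {W : FlatLattice M}
    (hW : W.val = Set.univ) : ExtensionBelow W := by
  have hE := hM.ground_eq
  intro F hF hr
  rw [hW] at hr ⊢
  obtain ⟨t, htF, ht⟩ := hM.exists_cover ha (F.closure_eq hE) (FlatLattice.admissible_of_lt hF) hr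
  have ht' : star t ∉ M.closure (insert t F.val) :=
    admissible_iff.1 ht t (subset_cl hE _ (.inl rfl))
  have ht'F : star t ∉ M.closure F.val := fun h =>
    ht' (M.closure_subset_closure (Set.subset_insert _ _) h)
  have had := (hM.admissible_closure_insert (by rwa [F.closure_eq hE]) ht').2
  have hr1 := rank_insert_le (M := M) t F.val
  have hr2 := rank_insert hE ht'F
  obtain ⟨H, hH, hHad, hHr⟩ := hM.exists_coatom ha
    (rank M Set.univ - (rank M (insert (star t) F.val) + 1)) _ had (by omega)
  have hs : SpansBelow W H := spansBelow_of_rank hW hHad (by omega)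
  refine ⟨t, htF, spansBelow_of_rank hW ht (by omega), hs.flat, ?_, hs.flat_lt, ?_, ?_⟩
  · exact (Set.subset_insert _ _).trans (hH.trans (subset_cl hE H))
  · exact fun h => admissible_iff.1 hHad t h (subset_cl hE H (hH (.inl rfl)))
  · rw [hs.val_flat, rank_closure, hHr]

/-- If some flat of rank one is admissible, the Möbius function has the sign given by the ranks
in the matroid. -/
lemma IsAdmissibleMatroid.moebius_sign (hM : IsAdmissibleMatroid M)
    (ha : ∃ a : J n, Admissible (M.closure {a})) {F W : FlatLattice M} (h : F ≤ W) {k : ℕ}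
    (hk : rank M F.val + k = rank M W.val) : 0 < (-1 : ℤ) ^ k * moebius F W := by
  have hE := hM.ground_eq
  rcases W.prop with hW | hW
  · exact RankedSymplectic.moebius_sign hE (exchangeBelow_of_admissible hE hW.2)
      (extensionBelow_of_admissible hE hW.2) k F h hk
  · exact RankedSymplectic.moebius_sign hE (hM.exchangeBelow hW)
      (hM.extensionBelow ha hW) k F h hk

/-! ### The rank function of the lattice of flats -/

lemma exists_flat_of_rank (hE : M.E = Set.univ) {F : FlatLattice M} (hF : Admissible F.val) {b : ℕ}
    (hb : b < rank M F.val) : ∃ G < F, rank M G.val = b := by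
  obtain ⟨I, hI⟩ := M.exists_isBasis F.val (by rw [hE]; exact Set.subset_univ _)
  have hIr : rank M F.val = I.ncard := by
    rw [← rank_closure, ← hI.closure_eq_closure, rank_closure, rank_of_indep hI.indep]
  obtain ⟨K, hKI, hK⟩ := Set.exists_subset_card_eq (s := I) (n := b) (by omega)
  have hKr : rank M K = b := by rw [rank_of_indep (hI.indep.subset hKI), hK]
  have hKF : M.closure K ⊆ F.val := F.closure_subset hE (hKI.trans hI.subset)
  refine ⟨⟨M.closure K, .inl ⟨M.isFlat_closure K, hF.subset hKF⟩⟩, ⟨hKF, fun h => ?_⟩, ?_⟩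
  · have := rank_mono (M := M) h
    rw [rank_closure] at this
    omega
  · exact (rank_closure K).trans hKr

/-- If some flat of rank one is admissible, the lattice of flats is graded by the rank of the
matroid. -/
lemma IsAdmissibleMatroid.latticeRank_eq (hM : IsAdmissibleMatroid M)
    (ha : ∃ a : J n, Admissible (M.closure {a})) (F : FlatLattice M) :
    latticeRank F = rank M F.val := by
  have hE := hM.ground_eq
  have key := Order.height_eq_of_strictMono (fun F : FlatLattice M => rank M F.val)
    (fun _ _ h => FlatLattice.rank_lt hE h) (fun F b hb => ?_) F
  · rw [latticeRank, key]
    simp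
  rcases F.prop with hF | hF
  · exact exists_flat_of_rank hE hF.2 hb
  · have hlo := hM.loopless
    have h0 : rank M (∅ : Set (J n)) = 0 := by simp [rank]
    have h_cl : M.closure ∅ = ∅ := M.loops_eq_empty
    rw [hF] at hb
    obtain ⟨H, -, hH, hHr⟩ := hM.exists_coatom ha (rank M Set.univ - 1) ∅
      (by rw [h_cl]; simp [Admissible]) (by omega)
    have hs : SpansBelow F H := spansBelow_of_rank hF hH (by omega)
    have hHr' : rank M hs.flat.val = rank M H := rank_closure H
    rcases Nat.lt_or_ge b (rank M H) with hbH | hbH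
    · obtain ⟨G, hG, hGr⟩ := exists_flat_of_rank hE (F := hs.flat) hH (hHr'.symm ▸ hbH)
      exact ⟨G, hG.trans hs.flat_lt, hGr⟩
    · exact ⟨hs.flat, hs.flat_lt, by rw [hHr']; omega⟩

/-! ### The case without admissible flats of rank one -/

/-- Without admissible flats of rank one, the lattice of flats has at most the elements `∅`
and `J`. -/
lemma eq_empty_and_eq_univ_of_lt (hE : M.E = Set.univ)
    (ha : ¬ ∃ a : J n, Admissible (M.closure {a})) {F G : FlatLattice M} (h : F < G) :
    F.val = ∅ ∧ G.val = Set.univ := by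
  have key (x : FlatLattice M) (hx : Admissible x.val) : x.val = ∅ := by
    by_contra hne
    obtain ⟨a, hax⟩ := Set.nonempty_iff_ne_empty.2 hne
    exact ha ⟨a, hx.subset (x.closure_subset hE (by simpa using hax))⟩
  refine ⟨key F (FlatLattice.admissible_of_lt h), ?_⟩
  rcases G.prop with hG | hG
  · have := FlatLattice.lt_iff.1 h
    rw [key G hG.2] at this
    exact (this.2 (Set.empty_subset _)).elim
  · exact hG

lemma covBy_of_forall_not_admissible (hE : M.E = Set.univ)
    (ha : ¬ ∃ a : J n, Admissible (M.closure {a})) {F G : FlatLattice M} (h : F < G) : F ⋖ G := by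
  refine ⟨h, fun x h1 h2 => ?_⟩
  have e1 := (eq_empty_and_eq_univ_of_lt hE ha h1).2
  have e2 := (eq_empty_and_eq_univ_of_lt hE ha h2).1
  have := FlatLattice.lt_iff.1 h1
  rw [e2] at this
  exact this.2 (Set.empty_subset _)

lemma latticeRank_of_lt (hE : M.E = Set.univ)
    (ha : ¬ ∃ a : J n, Admissible (M.closure {a})) {F G : FlatLattice M} (h : F < G) :
    latticeRank F = 0 ∧ latticeRank G = 1 := by
  have hmin (x : FlatLattice M) (hx : x < G) : Order.height x = 0 := by
    rw [Order.height_eq_zero, isMin_iff_forall_not_lt]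
    exact fun y hy => (covBy_of_forall_not_admissible hE ha (hy.trans hx)).2 hy hx
  have h1 : Order.height G = 1 := by
    refine le_antisymm ?_ ?_
    · exact_mod_cast Order.height_le_coe_iff (n := 1).2 fun y hy => by simp [hmin y hy]
    · simpa [hmin F h] using Order.height_add_one_le h
  simp [latticeRank, hmin F h, h1]

lemma negOnePow_sub_of_add_eq {a b k : ℕ} (h : a + k = b) :
    ((((a : ℤ) - (b : ℤ)).negOnePow : ℤˣ) : ℤ) = (-1) ^ k := by
  have : (a : ℤ) - b = -(k : ℤ) := by omega
  rw [this, Int.negOnePow_neg, Int.negOnePow_def]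
  simp

end RankedSymplectic

theorem theorem3p7 (n : ℕ) (S : RankedSymplectic.RankedSymplecticMatroid n)
    (M : Matroid (RankedSymplectic.J n)) (hM : RankedSymplectic.IsEnveloping M S.bases) :
    (∀ F₁ F₂ : RankedSymplectic.FlatLattice M, F₁ ≤ F₂ →
      0 < ((((RankedSymplectic.latticeRank F₁ : ℤ) -
          (RankedSymplectic.latticeRank F₂ : ℤ)).negOnePow : ℤˣ) : ℤ) *
        RankedSymplectic.moebius F₁ F₂) ∧
    ((2 ≤ RankedSymplectic.rank M Set.univ →
        ∃ a : RankedSymplectic.J n, RankedSymplectic.Admissible (M.closure {a})) →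
      ∀ F₁ F₂ : RankedSymplectic.FlatLattice M, F₁ ≤ F₂ →
        0 < ((((RankedSymplectic.rank M F₁.val : ℤ) -
            (RankedSymplectic.rank M F₂.val : ℤ)).negOnePow : ℤˣ) : ℤ) *
          RankedSymplectic.moebius F₁ F₂) := by
  open RankedSymplectic in
  have hE := hM.1.ground_eq
  by_cases ha : ∃ a : J n, Admissible (M.closure {a})
  · have key (F₁ F₂ : FlatLattice M) (h : F₁ ≤ F₂) :
        0 < ((((rank M F₁.val : ℤ) - (rank M F₂.val : ℤ)).negOnePow : ℤˣ) : ℤ) *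
          moebius F₁ F₂ := by
      have hk : rank M F₁.val + (rank M F₂.val - rank M F₁.val) = rank M F₂.val :=
        Nat.add_sub_of_le (rank_mono h)
      rw [negOnePow_sub_of_add_eq hk]
      exact hM.1.moebius_sign ha h hk
    refine ⟨fun F₁ F₂ h => ?_, fun _ => key⟩
    rw [hM.1.latticeRank_eq ha, hM.1.latticeRank_eq ha]
    exact key F₁ F₂ h
  · refine ⟨fun F₁ F₂ h => ?_, fun hr F₁ F₂ h => ?_⟩
    · rcases h.eq_or_lt with rfl | h
      · simp [moebius]
      · obtain ⟨h1, h2⟩ := latticeRank_of_lt hE ha h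
        rw [moebius_of_covBy (covBy_of_forall_not_admissible hE ha h),
          negOnePow_sub_of_add_eq (k := 1) (by omega)]
        simp
    · rcases h.eq_or_lt with rfl | h
      · simp [moebius]
      · have h1 := FlatLattice.rank_lt hE h
        have h2 : rank M F₂.val ≤ rank M Set.univ := rank_mono (Set.subset_univ _)
        -- Without admissible flats of rank one the hypothesis leaves only `r(J) ≤ 1`.
        have h3 : rank M Set.univ < 2 := lt_of_not_ge fun h => ha (hr h)
        rw [moebius_of_covBy (covBy_of_forall_not_admissible hE ha h),
          negOnePow_sub_of_add_eq (k := 1) (by omega)]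
        simp
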